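/- For $t>0$ let $I_0(t)=\frac1\pi\int_0^\pi e^{t\cos\theta}\,d\theta$ and $K_0(t)=\int_0^\infty e^{-t\cosh u}\,du$ be the modified Bessel functions of order zero. For integers $a,b,k\ge 0$ with $a<b$ define the (absolutely convergent) Bessel moment $$\mathrm{IKM}(a,b;2k+1)=\int_0^\infty I_0(t)^a K_0(t)^b\, t^{2k+1}\,dt .$$ (i) Let $a,b$ be integers with $1\le a<b$. Then the moments $\mathrm{IKM}(a,b;2k+1)$ with $k\in\mathbb Z$, $0\le k\le (a+b-1)/2$, are linearly dependent over $\mathbb Q$, i.e. there are rational numbers $c_k$, not all zero, with $\sum_{0\le k\le (a+b-1)/2} c_k\,\mathrm{IKM}(a,b;2k+1)=0$. Moreover, $$\dim_{\mathbb Q}\operatorname{span}_{\mathbb Q}\{\mathrm{IKM}(a,b;2k+1) : k\in\mathbb Z_{\ge0}\}\le\left\lfloor\frac{a+b-1}{2}\right\rfloor .$$ (ii) Let $n\ge 2$ be an integer. Then the number $1$ together with the moments $\mathrm{IKM}(0,n;2k+1)$, $k\in\mathbb Z$, $0\le k\le (n-1)/2$, are linearly dependent over $\mathbb Q$, i.e.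 there are rational numbers $c$ and $c_k$, not all zero, with $c+\sum_{0\le k\le (n-1)/2} c_k\,\mathrm{IKM}(0,n;2k+1)=0$. Moreover, $$\dim_{\mathbb Q}\operatorname{span}_{\mathbb Q}\{\mathrm{IKM}(0,n;2k+1) : k\in\mathbb Z_{\ge0}\}\le\left\lfloor\frac{n+1}{2}\right\rfloor .$$ Here $\lfloor x\rfloor$ is the greatest integer not exceeding $x$. -/

import Mathlib

open MeasureTheory

/-- The modified Bessel function of the first kind of order zero,
`I₀(t) = (1/π) ∫_0^π exp(t cos θ) dθ`. -/
noncomputable def besselI0 (t : ℝ) : ℝ :=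
  (1 / Real.pi) * ∫ θ in (0 : ℝ)..Real.pi, Real.exp (t * Real.cos θ)

/-- The modified Bessel function of the second kind of order zero,
`K₀(t) = ∫_0^∞ exp(-t cosh u) du`; only its values at `t > 0` are meaningful. -/
noncomputable def besselK0 (t : ℝ) : ℝ :=
  ∫ u in Set.Ioi (0 : ℝ), Real.exp (-t * Real.cosh u)

/-- The integrand `I₀(t)^a K₀(t)^b t^m` of a Bessel moment. -/
noncomputable def besselMomentIntegrand (a b m : ℕ) (t : ℝ) : ℝ :=
  besselI0 t ^ a * besselK0 t ^ b * t ^ m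

/-- The Bessel moment `IKM(a,b;m) = ∫_0^∞ I₀(t)^a K₀(t)^b t^m dt`. -/
noncomputable def IKM (a b m : ℕ) : ℝ :=
  ∫ t in Set.Ioi (0 : ℝ), besselMomentIntegrand a b m t

open Filter Topology

/-! Write θ = t d/dt and N = a + b. Both Bessel functions satisfy θ²f = t²f, so F = I₀ + K₀X and G =
θF satisfy θG = t²F. Let F_k be the coefficient of X^b in F^(N-k) G^k; then F_0 is a binomial
multiple of I₀^a K₀^b, and θF_k = (N-k) F_{k+1} + k t² F_{k-1} (`hasDerivAt_besselComponent`).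

Let A(k,m) be the normalised integral of t^(2m+1) F_k. Integrating the derivative of t^(2m+2) F_k
gives (2m+2) A(k,m) + (N-k) A(k+1,m) + k A(k-1,m+1) = 0 (`componentMoment_recurrence`). Unwinding it
expresses a multiple of A(k,m) through the moments A(0,m+j), j ≤ k/2, with rational coefficients of
strictly alternating sign, hence nonzero (`exists_alternating_expansion`). At k = N+1 the multiple
is zero, which leaves a recurrence of order ⌊(N+1)/2⌋ among the moments and bounds the dimension.

One further relation comes from F_N' = N t F_{N-1}, where the boundary term at 0 survives: θI₀ → 0
and θK₀ → -1 make it an integer, zero when a ≥ 1 (`componentMoment_boundary`). Expanding A(N-1,0)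
gives the asserted dependence, and for a ≥ 1 it lowers the dimension bound by one. -/

/-- The left endpoint enters only through a one-sided limit, because `besselK0 0` is a junk value
and continuity at 0 is unavailable. -/
theorem integral_Ioi_eq_sub_of_hasDerivAt_of_tendsto {f f' : ℝ → ℝ} {a l₀ l : ℝ}
    (hderiv : ∀ x ∈ Set.Ioi a, HasDerivAt f (f' x) x) (hint : IntegrableOn f' (Set.Ioi a))
    (h₀ : Tendsto f (𝓝[>] a) (𝓝 l₀)) (h : Tendsto f atTop (𝓝 l)) :
    ∫ x in Set.Ioi a, f' x = l - l₀ := by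
  have := integral_Ioi_deriv_mul_eq_sub (u := f) (u' := f') (v := fun _ => (1 : ℝ))
    (v' := fun _ => 0) (a := a) (a' := l₀) (b' := l) hderiv
    (fun x _ => hasDerivAt_const x 1) (by convert hint using 1; ext x; simp)
    (by convert h₀ using 1; ext x; simp) (by convert h using 1; ext x; simp)
  simpa using this

/-! ### The function `I₀` -/

/-- The derivatives of `π I₀`. -/
noncomputable def cosExpIntegral (m : ℕ) (t : ℝ) : ℝ :=
  ∫ θ in (0 : ℝ)..Real.pi, Real.cos θ ^ m * Real.exp (t * Real.cos θ)

theorem norm_cos_pow_mul_exp_le (m : ℕ) (t θ : ℝ) :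
    ‖Real.cos θ ^ m * Real.exp (t * Real.cos θ)‖ ≤ Real.exp |t| := by
  rw [norm_mul, norm_pow, Real.norm_eq_abs, Real.norm_eq_abs, Real.abs_exp]
  have h1 : |Real.cos θ| ^ m ≤ 1 := pow_le_one₀ (abs_nonneg _) (Real.abs_cos_le_one θ)
  have h2 : t * Real.cos θ ≤ |t| := by
    calc t * Real.cos θ ≤ |t * Real.cos θ| := le_abs_self _
      _ = |t| * |Real.cos θ| := abs_mul _ _
      _ ≤ |t| * 1 := by gcongr; exact Real.abs_cos_le_one θ
      _ = |t| := mul_one _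
  calc _ ≤ 1 * Real.exp |t| := by gcongr
    _ = _ := one_mul _

theorem hasDerivAt_cosExpIntegral (m : ℕ) (t : ℝ) :
    HasDerivAt (cosExpIntegral m) (cosExpIntegral (m + 1) t) t := by
  have hc : ∀ (m : ℕ) (t : ℝ), Continuous fun θ : ℝ =>
      Real.cos θ ^ m * Real.exp (t * Real.cos θ) := fun m t => by fun_prop
  refine (intervalIntegral.hasDerivAt_integral_of_dominated_loc_of_deriv_le
    (F := fun t θ => Real.cos θ ^ m * Real.exp (t * Real.cos θ))
    (F' := fun t θ => Real.cos θ ^ (m + 1) * Real.exp (t * Real.cos θ))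
    (bound := fun _ => Real.exp (|t| + 1))
    (Metric.ball_mem_nhds t one_pos) (.of_forall fun s => (hc m s).aestronglyMeasurable)
    ((hc m t).intervalIntegrable _ _) (hc _ t).aestronglyMeasurable
    (.of_forall fun θ _ s hs => ?_) intervalIntegrable_const
    (.of_forall fun θ _ s _ => ?_)).2
  · refine (norm_cos_pow_mul_exp_le _ _ _).trans (Real.exp_le_exp.2 ?_)
    rw [Metric.mem_ball, Real.dist_eq] at hs
    have := abs_sub_abs_le_abs_sub s t
    linarith
  · have := (((hasDerivAt_id s).mul_const (Real.cos θ)).exp).const_mul (Real.cos θ ^ m)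
    exact this.congr_deriv (by simp only [id]; ring)

theorem abs_cosExpIntegral_le (m : ℕ) {t : ℝ} (ht : 0 ≤ t) :
    |cosExpIntegral m t| ≤ Real.pi * Real.exp t := by
  have := intervalIntegral.norm_integral_le_of_norm_le_const (a := 0) (b := Real.pi)
    (f := fun θ : ℝ => Real.cos θ ^ m * Real.exp (t * Real.cos θ)) (C := Real.exp |t|)
    (fun θ _ => norm_cos_pow_mul_exp_le m t θ)
  rw [abs_of_nonneg ht, sub_zero, abs_of_pos Real.pi_pos, mul_comm] at this
  exact this

/-- Integrate the θ-derivative of sin θ · exp(t cos θ), which vanishes at both endpoints. -/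
theorem cosExpIntegral_bessel_equation (t : ℝ) :
    cosExpIntegral 1 t + t * cosExpIntegral 2 t = t * cosExpIntegral 0 t := by
  have h := intervalIntegral.integral_eq_sub_of_hasDerivAt (a := 0) (b := Real.pi)
    (f := fun θ : ℝ => Real.sin θ * Real.exp (t * Real.cos θ))
    (f' := fun θ : ℝ => Real.cos θ ^ 1 * Real.exp (t * Real.cos θ)
      + t * (Real.cos θ ^ 2 * Real.exp (t * Real.cos θ))
      - t * (Real.cos θ ^ 0 * Real.exp (t * Real.cos θ)))
    (fun θ _ => by
      have := (Real.hasDerivAt_sin θ).mul (((Real.hasDerivAt_cos θ).const_mul t).exp)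
      refine this.congr_deriv ?_
      have hs := Real.sin_sq_add_cos_sq θ
      linear_combination (-t * Real.exp (t * Real.cos θ)) * hs)
    (Continuous.intervalIntegrable (by fun_prop) _ _)
  rw [intervalIntegral.integral_sub, intervalIntegral.integral_add,
    intervalIntegral.integral_const_mul, intervalIntegral.integral_const_mul] at h
  · simp only [Real.sin_pi, Real.sin_zero, zero_mul, sub_self] at h
    unfold cosExpIntegral
    linarith
  all_goals exact Continuous.intervalIntegrable (by fun_prop) _ _

theorem besselI0_eq (t : ℝ) : besselI0 t = Real.pi⁻¹ * cosExpIntegral 0 t := by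
  simp [besselI0, cosExpIntegral]

/-- The function `t I₀'(t)`. -/
noncomputable def thetaI0 (t : ℝ) : ℝ := t * (Real.pi⁻¹ * cosExpIntegral 1 t)

theorem hasDerivAt_besselI0 {t : ℝ} (ht : 0 < t) : HasDerivAt besselI0 (thetaI0 t / t) t := by
  have h := (hasDerivAt_cosExpIntegral 0 t).const_mul Real.pi⁻¹
  rw [thetaI0, mul_div_cancel_left₀ _ ht.ne']
  exact h.congr_of_eventuallyEq (.of_forall besselI0_eq)

theorem hasDerivAt_thetaI0 (t : ℝ) : HasDerivAt thetaI0 (t * besselI0 t) t := by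
  have h := (hasDerivAt_id t).mul ((hasDerivAt_cosExpIntegral 1 t).const_mul Real.pi⁻¹)
  refine h.congr_deriv ?_
  have := cosExpIntegral_bessel_equation t
  rw [besselI0_eq]
  simp only [id]
  linear_combination Real.pi⁻¹ * this

theorem abs_besselI0_le {t : ℝ} (ht : 0 ≤ t) : |besselI0 t| ≤ Real.exp t := by
  rw [besselI0_eq, abs_mul, abs_of_pos (inv_pos.2 Real.pi_pos), inv_mul_le_iff₀ Real.pi_pos]
  exact abs_cosExpIntegral_le 0 ht

theorem abs_thetaI0_le {t : ℝ} (ht : 0 ≤ t) : |thetaI0 t| ≤ t * Real.exp t := by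
  rw [thetaI0, abs_mul, abs_of_nonneg ht, abs_mul, abs_of_pos (inv_pos.2 Real.pi_pos)]
  gcongr
  rw [inv_mul_le_iff₀ Real.pi_pos]
  exact abs_cosExpIntegral_le 1 ht

theorem tendsto_thetaI0_zero : Tendsto thetaI0 (𝓝[>] 0) (𝓝 0) := by
  have := (hasDerivAt_thetaI0 0).continuousAt.tendsto.mono_left
    (nhdsWithin_le_nhds (s := Set.Ioi (0 : ℝ)))
  simpa [thetaI0] using this

/-! ### The function `K₀` -/

/-- Up to sign, the derivatives of `K₀`. -/
noncomputable def coshExpIntegral (m : ℕ) (t : ℝ) : ℝ :=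
  ∫ u in Set.Ioi (0 : ℝ), Real.cosh u ^ m * Real.exp (-t * Real.cosh u)

/-- A single term of the exponential series bounds cosh^(m+1) by a multiple of exp(t cosh u); the
extra factor cosh u ≥ e^u / 2 supplies the decay in u. -/
theorem exists_cosh_pow_mul_exp_le (m : ℕ) {t : ℝ} (ht : 0 < t) :
    ∃ C : ℝ, ∀ u, Real.cosh u ^ m * Real.exp (-t * Real.cosh u) ≤ C * Real.exp (-1 * u) := by
  refine ⟨2 * ((m + 1).factorial / t ^ (m + 1)), fun u => ?_⟩
  have hc := Real.cosh_pos u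
  have h1 := Real.pow_div_factorial_le_exp (t * Real.cosh u) (by positivity) (m + 1)
  have h2 : Real.exp u / 2 ≤ Real.cosh u := by
    rw [Real.cosh_eq]; linarith [Real.exp_pos (-u)]
  have hf : (0 : ℝ) < (m + 1).factorial := by positivity
  rw [div_le_iff₀ hf, mul_pow] at h1
  rw [neg_mul, Real.exp_neg, neg_mul, one_mul, Real.exp_neg]
  have h3 : Real.cosh u ^ m * Real.exp u ≤
      2 * ((m + 1).factorial / t ^ (m + 1)) * Real.exp (t * Real.cosh u) := by
    calc Real.cosh u ^ m * Real.exp u ≤ Real.cosh u ^ m * (2 * Real.cosh u) := by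
          gcongr; linarith
      _ = 2 * Real.cosh u ^ (m + 1) := by ring
      _ ≤ _ := by
          rw [mul_assoc]
          gcongr
          rw [div_mul_eq_mul_div, le_div_iff₀ (by positivity)]
          linarith
  rw [← div_eq_mul_inv, ← div_eq_mul_inv, div_le_div_iff₀ (Real.exp_pos _) (Real.exp_pos _)]
  exact h3

theorem integrableOn_cosh_pow_mul_exp (m : ℕ) {t : ℝ} (ht : 0 < t) :
    IntegrableOn (fun u => Real.cosh u ^ m * Real.exp (-t * Real.cosh u)) (Set.Ioi 0) := by
  obtain ⟨C, hC⟩ := exists_cosh_pow_mul_exp_le m ht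
  refine Integrable.mono' ((exp_neg_integrableOn_Ioi 0 one_pos).const_mul C)
    (Continuous.aestronglyMeasurable (by fun_prop)) (.of_forall fun u => ?_)
  have hc := Real.cosh_pos u
  rw [Real.norm_of_nonneg (by positivity)]
  exact hC u

theorem hasDerivAt_coshExpIntegral (m : ℕ) {t : ℝ} (ht : 0 < t) :
    HasDerivAt (coshExpIntegral m) (-coshExpIntegral (m + 1) t) t := by
  have hc : ∀ (m : ℕ) (t : ℝ), Continuous fun u : ℝ =>
      Real.cosh u ^ m * Real.exp (-t * Real.cosh u) := fun m t => by fun_prop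
  have h := (hasDerivAt_integral_of_dominated_loc_of_deriv_le
    (μ := volume.restrict (Set.Ioi (0 : ℝ)))
    (F := fun t u => Real.cosh u ^ m * Real.exp (-t * Real.cosh u))
    (F' := fun t u => -(Real.cosh u ^ (m + 1) * Real.exp (-t * Real.cosh u)))
    -- For s > t/2 the integrand at s is dominated by the one at t/2, which is still integrable.
    (bound := fun u => Real.cosh u ^ (m + 1) * Real.exp (-(t / 2) * Real.cosh u))
    (Ioi_mem_nhds (half_lt_self ht)) (.of_forall fun s => (hc m s).aestronglyMeasurable)
    (integrableOn_cosh_pow_mul_exp m ht) (hc _ t).neg.aestronglyMeasurable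
    (.of_forall fun u s hs => ?_) (integrableOn_cosh_pow_mul_exp (m + 1) (half_pos ht))
    (.of_forall fun u s _ => ?_)).2
  · rw [integral_neg] at h
    exact h
  · have hu := Real.cosh_pos u
    rw [norm_neg, Real.norm_of_nonneg (by positivity)]
    gcongr
    exact le_of_lt hs
  · have := (((hasDerivAt_id s).neg.mul_const (Real.cosh u)).exp).const_mul (Real.cosh u ^ m)
    exact this.congr_deriv (by simp only [Pi.neg_apply, id]; ring)

theorem besselK0_eq : besselK0 = coshExpIntegral 0 := by
  ext t
  simp [besselK0, coshExpIntegral]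

theorem tendsto_exp_neg_mul_cosh {t : ℝ} (ht : 0 < t) :
    Tendsto (fun u => Real.exp (-t * Real.cosh u)) atTop (𝓝 0) := by
  obtain ⟨C, hC⟩ := exists_cosh_pow_mul_exp_le 0 ht
  refine squeeze_zero (fun u => (Real.exp_pos _).le) (fun u => by simpa using hC u) ?_
  simpa using (Real.tendsto_exp_neg_atTop_nhds_zero.const_mul C)

theorem tendsto_sinh_mul_exp {t : ℝ} (ht : 0 < t) :
    Tendsto (fun u => Real.sinh u * Real.exp (-t * Real.cosh u)) atTop (𝓝 0) := by
  obtain ⟨C, hC⟩ := exists_cosh_pow_mul_exp_le 1 ht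
  refine squeeze_zero' (g := fun u => C * Real.exp (-u)) ?_ (.of_forall fun u => ?_) ?_
  · filter_upwards [eventually_ge_atTop 0] with u hu
    have := Real.sinh_nonneg_iff.2 hu
    positivity
  · refine le_trans ?_ (by simpa only [pow_one, neg_one_mul] using hC u)
    gcongr
    exact (Real.sinh_lt_cosh u).le
  · simpa using (Real.tendsto_exp_neg_atTop_nhds_zero.const_mul C)

theorem coshExpIntegral_bessel_equation {t : ℝ} (ht : 0 < t) :
    t * coshExpIntegral 2 t - coshExpIntegral 1 t = t * coshExpIntegral 0 t := by
  have hi := fun m => integrableOn_cosh_pow_mul_exp m ht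
  have h12 : IntegrableOn (fun u => Real.cosh u ^ 1 * Real.exp (-t * Real.cosh u)
      - t * (Real.cosh u ^ 2 * Real.exp (-t * Real.cosh u))) (Set.Ioi 0) :=
    (hi 1).sub ((hi 2).const_mul t)
  have h := integral_Ioi_of_hasDerivAt_of_tendsto' (a := 0)
    (f := fun u : ℝ => Real.sinh u * Real.exp (-t * Real.cosh u))
    (f' := fun u : ℝ => Real.cosh u ^ 1 * Real.exp (-t * Real.cosh u)
      - t * (Real.cosh u ^ 2 * Real.exp (-t * Real.cosh u))
      + t * (Real.cosh u ^ 0 * Real.exp (-t * Real.cosh u)))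
    (fun u _ => by
      have := (Real.hasDerivAt_sinh u).mul (((Real.hasDerivAt_cosh u).const_mul (-t)).exp)
      refine this.congr_deriv ?_
      have hs := Real.cosh_sq u
      linear_combination (t * Real.exp (-t * Real.cosh u)) * hs)
    (h12.add ((hi 0).const_mul t)) (tendsto_sinh_mul_exp ht)
  rw [integral_add h12 ((hi 0).const_mul t),
    integral_sub (hi 1) ((hi 2).const_mul t), integral_const_mul, integral_const_mul] at h
  simp only [Real.sinh_zero, zero_mul, sub_self] at h
  unfold coshExpIntegral
  linarith

/-- The function `t K₀'(t)`. -/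
noncomputable def thetaK0 (t : ℝ) : ℝ := -(t * coshExpIntegral 1 t)

theorem hasDerivAt_besselK0 {t : ℝ} (ht : 0 < t) : HasDerivAt besselK0 (thetaK0 t / t) t := by
  rw [thetaK0, neg_div, mul_div_cancel_left₀ _ ht.ne', besselK0_eq]
  exact hasDerivAt_coshExpIntegral 0 ht

theorem hasDerivAt_thetaK0 {t : ℝ} (ht : 0 < t) : HasDerivAt thetaK0 (t * besselK0 t) t := by
  have h := ((hasDerivAt_id t).mul (hasDerivAt_coshExpIntegral 1 ht)).neg
  refine h.congr_deriv ?_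
  have := coshExpIntegral_bessel_equation ht
  rw [besselK0_eq]
  simp only [id]
  linear_combination this

theorem besselK0_nonneg (t : ℝ) : 0 ≤ besselK0 t :=
  setIntegral_nonneg measurableSet_Ioi fun _ _ => (Real.exp_pos _).le

theorem integral_sinh_mul_exp {t : ℝ} (ht : 0 < t) :
    IntegrableOn (fun u => t * Real.sinh u * Real.exp (-t * Real.cosh u)) (Set.Ioi 0) ∧
    ∫ u in Set.Ioi (0 : ℝ), t * Real.sinh u * Real.exp (-t * Real.cosh u) = Real.exp (-t) := by
  have hint : IntegrableOn (fun u => t * Real.sinh u * Real.exp (-t * Real.cosh u))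
      (Set.Ioi 0) := by
    refine Integrable.mono' ((integrableOn_cosh_pow_mul_exp 1 ht).const_mul t)
      (Continuous.aestronglyMeasurable (by fun_prop)) ?_
    filter_upwards [ae_restrict_mem measurableSet_Ioi] with u hu
    have h0 := Real.sinh_nonneg_iff.2 (le_of_lt hu)
    rw [Real.norm_of_nonneg (by positivity), pow_one, mul_assoc]
    gcongr
    exact (Real.sinh_lt_cosh u).le
  refine ⟨hint, ?_⟩
  have h := integral_Ioi_of_hasDerivAt_of_tendsto' (a := 0)
    (f := fun u : ℝ => -Real.exp (-t * Real.cosh u))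
    (f' := fun u : ℝ => t * Real.sinh u * Real.exp (-t * Real.cosh u))
    (fun u _ => by
      have := (((Real.hasDerivAt_cosh u).const_mul (-t)).exp).neg
      exact this.congr_deriv (by ring)) hint (tendsto_exp_neg_mul_cosh ht).neg
  rw [h]
  simp

/-- Replacing cosh by sinh in the integral for -θK₀ makes it exactly e^(-t). This bound and the next
follow from sinh ≤ cosh ≤ sinh + 1 on u > 0, and together they pin down θK₀ near 0. -/
theorem exp_neg_le_neg_thetaK0 {t : ℝ} (ht : 0 < t) : Real.exp (-t) ≤ -thetaK0 t := by
  obtain ⟨hi, h⟩ := integral_sinh_mul_exp ht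
  rw [thetaK0, neg_neg, ← h, coshExpIntegral, ← integral_const_mul]
  refine setIntegral_mono hi ((integrableOn_cosh_pow_mul_exp 1 ht).const_mul t) fun u => ?_
  simp only [pow_one, mul_assoc]
  gcongr
  exact (Real.sinh_lt_cosh u).le

theorem neg_thetaK0_le {t : ℝ} (ht : 0 < t) :
    -thetaK0 t ≤ Real.exp (-t) + t * besselK0 t := by
  obtain ⟨hi, h⟩ := integral_sinh_mul_exp ht
  have h0 := (integrableOn_cosh_pow_mul_exp 0 ht).const_mul t
  rw [thetaK0, neg_neg, ← h, besselK0_eq, coshExpIntegral, coshExpIntegral, ← integral_const_mul,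
    ← integral_const_mul, ← integral_add hi h0]
  refine setIntegral_mono_on ((integrableOn_cosh_pow_mul_exp 1 ht).const_mul t) (hi.add h0)
    measurableSet_Ioi fun u hu => ?_
  have hu : (0 : ℝ) < u := hu
  have h1 : Real.cosh u ≤ Real.sinh u + 1 := by
    have := Real.cosh_sub_sinh u
    have : Real.exp (-u) ≤ 1 := Real.exp_le_one_iff.2 (by linarith)
    linarith
  calc t * (Real.cosh u ^ 1 * Real.exp (-t * Real.cosh u))
      ≤ t * ((Real.sinh u + 1) * Real.exp (-t * Real.cosh u)) := by rw [pow_one]; gcongr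
    _ = _ := by ring

/-- Compare with t = 1: e^s K₀(s) + log s is increasing by `neg_thetaK0_le`, which serves t ≤ 1,
while e^s K₀(s) is decreasing because 1 ≤ cosh, which serves t ≥ 1. -/
theorem exp_mul_besselK0_le {t : ℝ} (ht : 0 < t) :
    Real.exp t * besselK0 t ≤ Real.exp 1 * besselK0 1 + max 0 (-Real.log t) := by
  have hd : ∀ s : ℝ, 0 < s → HasDerivAt (fun s => Real.exp s * besselK0 s)
      (Real.exp s * besselK0 s + Real.exp s * (thetaK0 s / s)) s := fun s hs =>
    (Real.hasDerivAt_exp s).mul (hasDerivAt_besselK0 hs)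
  rcases le_total t 1 with h1 | h1
  · have hd' : ∀ s : ℝ, 0 < s → HasDerivAt (fun s => Real.exp s * besselK0 s + Real.log s)
      (Real.exp s * besselK0 s + Real.exp s * (thetaK0 s / s) + s⁻¹) s := fun s hs =>
      (hd s hs).add (Real.hasDerivAt_log hs.ne')
    have hm : MonotoneOn (fun s => Real.exp s * besselK0 s + Real.log s) (Set.Ioi 0) := by
      refine monotoneOn_of_deriv_nonneg (convex_Ioi 0)
        (fun s hs => (hd' s hs).continuousAt.continuousWithinAt)
        (fun s hs => (hd' s (interior_subset hs)).differentiableAt.differentiableWithinAt)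
        fun s hs => ?_
      have hs : 0 < s := interior_subset hs
      rw [(hd' s hs).deriv]
      have h2 := neg_thetaK0_le hs
      have h3 : Real.exp s * Real.exp (-s) = 1 := by rw [← Real.exp_add]; simp
      have h4 : 0 ≤ Real.exp s * (Real.exp (-s) + s * besselK0 s + thetaK0 s) :=
        mul_nonneg (Real.exp_pos s).le (by linarith)
      have h5 : Real.exp s * besselK0 s + Real.exp s * (thetaK0 s / s) + s⁻¹ =
          Real.exp s * (Real.exp (-s) + s * besselK0 s + thetaK0 s) / s := by
        field_simp
        linear_combination -h3
      rw [h5]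
      positivity
    have := hm (Set.mem_Ioi.2 ht) (Set.mem_Ioi.2 one_pos) h1
    simp only [Real.log_one, add_zero] at this
    linarith [le_max_right 0 (-Real.log t)]
  · have hm : AntitoneOn (fun s => Real.exp s * besselK0 s) (Set.Ioi 0) := by
      refine antitoneOn_of_deriv_nonpos (convex_Ioi 0)
        (fun s hs => (hd s hs).continuousAt.continuousWithinAt)
        (fun s hs => (hd s (interior_subset hs)).differentiableAt.differentiableWithinAt)
        fun s hs => ?_
      have hs : 0 < s := interior_subset hs
      rw [(hd s hs).deriv, thetaK0, neg_div, mul_div_cancel_left₀ _ hs.ne', ← mul_add]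
      refine mul_nonpos_of_nonneg_of_nonpos (Real.exp_pos s).le ?_
      rw [besselK0_eq, ← sub_eq_add_neg, sub_nonpos]
      refine setIntegral_mono (integrableOn_cosh_pow_mul_exp 0 hs)
        (integrableOn_cosh_pow_mul_exp 1 hs) fun u => ?_
      simp only [pow_one, pow_zero]
      gcongr
      exact Real.one_le_cosh u
    have := hm (Set.mem_Ioi.2 one_pos) (Set.mem_Ioi.2 ht) h1
    simp only at this
    linarith [le_max_left 0 (-Real.log t)]

theorem rpow_le_one_add {δ : ℝ} (hδ : 0 ≤ δ) (hδ' : δ ≤ 1) {t : ℝ} (ht : 0 ≤ t) :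
    t ^ δ ≤ 1 + t := by
  rcases le_total t 1 with h | h
  · linarith [Real.rpow_le_one ht h hδ]
  · have := Real.rpow_le_rpow_of_exponent_le h hδ'
    rw [Real.rpow_one] at this
    linarith

/-- The logarithmic singularity is traded for an arbitrarily small power t^(-δ), which behaves well
under products. -/
theorem exists_besselK0_le {δ : ℝ} (hδ : 0 < δ) (hδ' : δ ≤ 1) :
    ∃ C : ℝ, 0 ≤ C ∧ ∀ t : ℝ, 0 < t →
      besselK0 t ≤ C * ((1 + t) * t ^ (-δ)) * Real.exp (-t) := by
  have h1 : 0 ≤ Real.exp 1 * besselK0 1 := mul_nonneg (Real.exp_pos 1).le (besselK0_nonneg 1)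
  refine ⟨Real.exp 1 * besselK0 1 + 1 / δ, by positivity, fun t ht => ?_⟩
  have hp : 0 < t ^ δ := Real.rpow_pos_of_pos ht δ
  have hlog : max 0 (-Real.log t) * t ^ δ ≤ 1 / δ := by
    rw [max_mul_of_nonneg _ _ hp.le, zero_mul]
    refine max_le (by positivity) ?_
    have := Real.log_le_rpow_div (inv_nonneg.2 ht.le) hδ
    rw [Real.log_inv, Real.inv_rpow ht.le] at this
    calc -Real.log t * t ^ δ ≤ (t ^ δ)⁻¹ / δ * t ^ δ := by gcongr
      _ = 1 / δ := by field_simp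
  have h2 := exp_mul_besselK0_le ht
  have h3 := rpow_le_one_add hδ.le hδ' ht.le
  rw [Real.rpow_neg ht.le, Real.exp_neg, ← div_eq_mul_inv, le_div_iff₀ (Real.exp_pos t),
    ← div_eq_mul_inv, ← mul_div_assoc, le_div_iff₀ hp]
  have h4 : 1 / δ ≤ 1 / δ * (1 + t) := le_mul_of_one_le_right (by positivity) (by linarith)
  calc besselK0 t * Real.exp t * t ^ δ = Real.exp t * besselK0 t * t ^ δ := by ring
    _ ≤ (Real.exp 1 * besselK0 1 + max 0 (-Real.log t)) * t ^ δ := by gcongr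
    _ = Real.exp 1 * besselK0 1 * t ^ δ + max 0 (-Real.log t) * t ^ δ := by ring
    _ ≤ Real.exp 1 * besselK0 1 * (1 + t) + 1 / δ * (1 + t) :=
        add_le_add (mul_le_mul_of_nonneg_left h3 h1) (hlog.trans h4)
    _ = _ := by ring

theorem tendsto_thetaK0_zero : Tendsto thetaK0 (𝓝[>] 0) (𝓝 (-1)) := by
  obtain ⟨C, hC, h⟩ := exists_besselK0_le (δ := 1 / 2) (by norm_num) (by norm_num)
  have hl : Tendsto (fun t : ℝ => Real.exp (-t)) (𝓝[>] 0) (𝓝 1) := by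
    have : Continuous fun t : ℝ => Real.exp (-t) := by fun_prop
    simpa using (this.tendsto 0).mono_left (nhdsWithin_le_nhds (s := Set.Ioi (0 : ℝ)))
  have hu : Tendsto (fun t : ℝ => Real.exp (-t) + C * (1 + t) * t ^ (1 / 2 : ℝ) * Real.exp (-t))
      (𝓝[>] 0) (𝓝 1) := by
    have : Continuous fun t : ℝ =>
        Real.exp (-t) + C * (1 + t) * t ^ (1 / 2 : ℝ) * Real.exp (-t) := by
      have := Real.continuous_rpow_const (q := 1 / 2) (by norm_num)
      fun_prop
    simpa using (this.tendsto 0).mono_left (nhdsWithin_le_nhds (s := Set.Ioi (0 : ℝ)))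
  have key : Tendsto (fun t => -thetaK0 t) (𝓝[>] 0) (𝓝 1) := by
    refine tendsto_of_tendsto_of_tendsto_of_le_of_le' hl hu ?_ ?_
    · filter_upwards [self_mem_nhdsWithin] with t ht using exp_neg_le_neg_thetaK0 ht
    · filter_upwards [self_mem_nhdsWithin] with t ht
      have ht : 0 < t := ht
      refine (neg_thetaK0_le ht).trans ?_
      have h1 : t * t ^ (-(1 / 2) : ℝ) = t ^ (1 / 2 : ℝ) := by
        rw [← Real.rpow_one_add' ht.le (by norm_num)]
        norm_num
      have h2 := mul_le_mul_of_nonneg_left (h t ht) ht.le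
      rw [← h1]
      linarith
  simpa using key.neg

/-! ### Coefficientwise calculus and growth of polynomial families -/

open Polynomial in
theorem Polynomial.coeff_C_add_C_mul_X_pow {R : Type*} [CommSemiring R] (x y : R) (n k : ℕ) :
    ((C x + C y * X) ^ n).coeff k = n.choose k * (x ^ (n - k) * y ^ k) := by
  rw [add_comm, add_pow, finsetSum_coeff]
  have h : ∀ i ∈ Finset.range (n + 1), ((C y * X) ^ i * C x ^ (n - i) * (n.choose i : R[X])).coeff k
      = if i = k then n.choose k * (x ^ (n - k) * y ^ k) else 0 := by
    intro i _
    have : (C y * X) ^ i * C x ^ (n - i) * (n.choose i : R[X]) =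
        C (n.choose i * (x ^ (n - i) * y ^ i)) * X ^ i := by
      simp only [map_mul, map_pow, map_natCast]
      ring
    rw [this, coeff_C_mul_X_pow]
    by_cases hik : k = i
    · subst hik; simp
    · rw [if_neg hik, if_neg (Ne.symm hik)]
  rw [Finset.sum_congr rfl h, Finset.sum_ite_eq']
  split_ifs with hk
  · rfl
  · rw [Nat.choose_eq_zero_of_lt (by simpa using hk)]
    simp

section CoeffCalculus

open Polynomial

/-- Coefficientwise differentiability of a family of polynomials. -/
def HasCoeffDerivAt (P : ℝ → ℝ[X]) (Q : ℝ[X]) (t : ℝ) : Prop :=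
  ∀ n, HasDerivAt (fun s => (P s).coeff n) (Q.coeff n) t

theorem HasCoeffDerivAt.mul {P R : ℝ → ℝ[X]} {Q S : ℝ[X]} {t : ℝ}
    (hP : HasCoeffDerivAt P Q t) (hR : HasCoeffDerivAt R S t) :
    HasCoeffDerivAt (fun s => P s * R s) (Q * R t + P t * S) t := by
  intro n
  simp only [coeff_mul, coeff_add, ← Finset.sum_add_distrib]
  exact HasDerivAt.fun_sum fun i _ => (hP i.1).mul (hR i.2)

theorem HasCoeffDerivAt.pow {P : ℝ → ℝ[X]} {Q : ℝ[X]} {t : ℝ} (hP : HasCoeffDerivAt P Q t)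
    (n : ℕ) : HasCoeffDerivAt (fun s => P s ^ n) (C (n : ℝ) * P t ^ (n - 1) * Q) t := by
  induction n with
  | zero => intro k; simpa using hasDerivAt_const t _
  | succ n ih =>
    have h := ih.mul hP
    have e : C (n : ℝ) * P t ^ (n - 1) * Q * P t + P t ^ n * Q =
        C ((n + 1 : ℕ) : ℝ) * P t ^ (n + 1 - 1) * Q := by
      rcases n with _ | n
      · simp
      · simp only [Nat.add_sub_cancel, Nat.cast_add, Nat.cast_one, map_add, map_one]
        ring
    rw [e] at h
    simpa only [pow_succ] using h

/-- The `n`-th coefficient is `O(w(t)^d e^{(d-2n)t})` on `t > 0`, for each `n`. -/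
def CoeffBound (w : ℝ → ℝ) (P : ℝ → ℝ[X]) (d : ℕ) : Prop :=
  ∀ n : ℕ, ∃ c : ℝ, ∀ t, 0 < t →
    |(P t).coeff n| ≤ c * (w t ^ d * Real.exp (((d : ℝ) - 2 * n) * t))

/-- The exponent d - 2n is additive in (d, n), so all terms of the convolution have the same growth
rate. -/
theorem CoeffBound.mul {w : ℝ → ℝ} {P R : ℝ → ℝ[X]} {d e : ℕ} (hP : CoeffBound w P d)
    (hR : CoeffBound w R e) : CoeffBound w (fun t => P t * R t) (d + e) := by
  intro n
  choose c hc using hP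
  choose c' hc' using hR
  refine ⟨∑ i ∈ Finset.HasAntidiagonal.antidiagonal n, c i.1 * c' i.2, fun t ht => ?_⟩
  rw [coeff_mul, Finset.sum_mul]
  refine (Finset.abs_sum_le_sum_abs _ _).trans (Finset.sum_le_sum fun i hi => ?_)
  have hi : (n : ℝ) = i.1 + i.2 := by
    rw [← Finset.HasAntidiagonal.mem_antidiagonal.1 hi, Nat.cast_add]
  rw [abs_mul]
  refine (mul_le_mul (hc _ t ht) (hc' _ t ht) (abs_nonneg _)
    ((abs_nonneg _).trans (hc _ t ht))).trans_eq ?_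
  have he : Real.exp ((((d + e : ℕ) : ℝ) - 2 * n) * t) =
      Real.exp (((d : ℝ) - 2 * i.1) * t) * Real.exp (((e : ℝ) - 2 * i.2) * t) := by
    rw [← Real.exp_add, hi]
    push_cast
    ring_nf
  rw [he, pow_add]
  ring

theorem CoeffBound.pow {w : ℝ → ℝ} {P : ℝ → ℝ[X]} {d : ℕ} (hP : CoeffBound w P d) (k : ℕ) :
    CoeffBound w (fun t => P t ^ k) (k * d) := by
  induction k with
  | zero =>
    intro n
    rcases n with _ | n
    · exact ⟨1, fun t _ => by simp⟩
    · exact ⟨0, fun t _ => by simp [coeff_one]⟩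
  | succ k ih =>
    have := ih.mul hP
    simpa only [pow_succ, Nat.succ_mul] using this

theorem coeffBound_linear {w f g : ℝ → ℝ} {c₀ c₁ : ℝ}
    (hf : ∀ t, 0 < t → |f t| ≤ c₀ * (w t * Real.exp t))
    (hg : ∀ t, 0 < t → |g t| ≤ c₁ * (w t * Real.exp (-t))) :
    CoeffBound w (fun t => C (f t) + C (g t) * X) 1 := by
  rintro (_ | _ | n)
  · exact ⟨c₀, fun t ht => by simpa using hf t ht⟩
  · refine ⟨c₁, fun t ht => ?_⟩
    have : (((1 : ℕ) : ℝ) - 2 * ((0 + 1 : ℕ) : ℝ)) * t = -t := by push_cast; ring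
    rw [this]
    simpa [coeff_C] using hg t ht
  · exact ⟨0, fun t ht => by simp⟩

end CoeffCalculus

/-! ### The components F_k and their differential system -/

section BesselPolynomials

open Polynomial

/-- The generating polynomial `I₀ + K₀ X`. -/
noncomputable def besselPoly (t : ℝ) : ℝ[X] := C (besselI0 t) + C (besselK0 t) * X

/-- The image of `besselPoly` under `t d/dt`. -/
noncomputable def thetaPoly (t : ℝ) : ℝ[X] := C (thetaI0 t) + C (thetaK0 t) * X

theorem hasCoeffDerivAt_linear {f g : ℝ → ℝ} {f' g' t : ℝ} (hf : HasDerivAt f f' t)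
    (hg : HasDerivAt g g' t) :
    HasCoeffDerivAt (fun s => C (f s) + C (g s) * X) (C f' + C g' * X) t := by
  rintro (_ | _ | n)
  · simpa using hf
  · simpa [coeff_C] using hg
  · simpa [coeff_C, coeff_X] using hasDerivAt_const t (0 : ℝ)

theorem hasCoeffDerivAt_besselPoly {t : ℝ} (ht : 0 < t) :
    HasCoeffDerivAt besselPoly (C t⁻¹ * thetaPoly t) t := by
  have h := hasCoeffDerivAt_linear (hasDerivAt_besselI0 ht) (hasDerivAt_besselK0 ht)
  have e : C t⁻¹ * thetaPoly t = C (thetaI0 t / t) + C (thetaK0 t / t) * X := by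
    simp only [thetaPoly, div_eq_mul_inv, map_mul]
    ring
  rw [e]
  exact h

theorem hasCoeffDerivAt_thetaPoly {t : ℝ} (ht : 0 < t) :
    HasCoeffDerivAt thetaPoly (C t * besselPoly t) t := by
  have h := hasCoeffDerivAt_linear (hasDerivAt_thetaI0 t) (hasDerivAt_thetaK0 ht)
  have e : C t * besselPoly t = C (t * besselI0 t) + C (t * besselK0 t) * X := by
    simp only [besselPoly, map_mul]
    ring
  rw [e]
  exact h

/-- The component of `X ^ b` in `(I₀ + K₀ X) ^ (N - k) (θI₀ + θK₀ X) ^ k`. -/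
noncomputable def besselComponent (N b k : ℕ) (t : ℝ) : ℝ :=
  (besselPoly t ^ (N - k) * thetaPoly t ^ k).coeff b

theorem besselComponent_zero (a b : ℕ) (t : ℝ) :
    besselComponent (a + b) b 0 t = (a + b).choose b * (besselI0 t ^ a * besselK0 t ^ b) := by
  rw [besselComponent, pow_zero, mul_one, Nat.sub_zero, besselPoly, coeff_C_add_C_mul_X_pow,
    Nat.add_sub_cancel]

theorem besselComponent_self (a b : ℕ) (t : ℝ) :
    besselComponent (a + b) b (a + b) t =
      (a + b).choose b * (thetaI0 t ^ a * thetaK0 t ^ b) := by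
  rw [besselComponent, Nat.sub_self, pow_zero, one_mul, thetaPoly, coeff_C_add_C_mul_X_pow,
    Nat.add_sub_cancel]

theorem hasDerivAt_besselComponent {N b k : ℕ} (hk : k ≤ N) {t : ℝ} (ht : 0 < t) :
    HasDerivAt (besselComponent N b k)
      (((N : ℝ) - k) * t⁻¹ * besselComponent N b (k + 1) t
        + k * t * besselComponent N b (k - 1) t) t := by
  have h := (((hasCoeffDerivAt_besselPoly ht).pow (N - k)).mul
    ((hasCoeffDerivAt_thetaPoly ht).pow k)) b
  refine h.congr_deriv ?_
  have e : C (((N - k : ℕ) : ℝ)) * besselPoly t ^ (N - k - 1) * (C t⁻¹ * thetaPoly t)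
        * thetaPoly t ^ k
      + besselPoly t ^ (N - k) * (C (k : ℝ) * thetaPoly t ^ (k - 1) * (C t * besselPoly t)) =
      C (((N : ℝ) - k) * t⁻¹) * (besselPoly t ^ (N - (k + 1)) * thetaPoly t ^ (k + 1))
      + C (k * t) * (besselPoly t ^ (N - (k - 1)) * thetaPoly t ^ (k - 1)) := by
    rw [Nat.cast_sub hk, Nat.sub_sub]
    -- At k = 0 the truncated index `k - 1` is harmless, since its term carries the factor k.
    rcases k with _ | k
    · simp only [map_mul, Nat.cast_zero, map_zero]
      ring
    · have : N - (k + 1 - 1) = N - (k + 1) + 1 := by omega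
      rw [this]
      simp only [map_mul]
      ring
  rw [e, coeff_add, coeff_C_mul, coeff_C_mul]
  rfl

theorem continuousOn_besselComponent {N b k : ℕ} (hk : k ≤ N) :
    ContinuousOn (besselComponent N b k) (Set.Ioi 0) := fun _ ht =>
  (hasDerivAt_besselComponent hk ht).continuousAt.continuousWithinAt

end BesselPolynomials

/-! ### Decay and integrability of the components -/

theorem exists_besselComponent_bound {N : ℕ} (hN : 0 < N) {b k : ℕ} (hk : k ≤ N) :
    ∃ c : ℝ, ∀ t, 0 < t → t * |besselComponent N b k t| ≤
      c * ((1 + t) ^ (2 * N) * Real.exp (((N : ℝ) - 2 * b) * t)) := by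
  have hN' : (0 : ℝ) < N := by exact_mod_cast hN
  have hδ : (0 : ℝ) < (N : ℝ)⁻¹ := inv_pos.2 hN'
  have hδ' : (N : ℝ)⁻¹ ≤ 1 := inv_le_one_of_one_le₀ (by exact_mod_cast hN)
  set δ : ℝ := (N : ℝ)⁻¹ with hδdef
  obtain ⟨c, hc, hK⟩ := exists_besselK0_le hδ hδ'
  -- With δ = 1/N, the N-th power of w has only a simple pole at 0, so one factor t turns it into
  -- the polynomial (1+t)^(2N).
  set w : ℝ → ℝ := fun t => (1 + t) ^ 2 * t ^ (-δ) with hw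
  have hv : ∀ t : ℝ, 0 < t → 1 ≤ (1 + t) * t ^ (-δ) := fun t ht => by
    rw [Real.rpow_neg ht.le, ← div_eq_mul_inv, one_le_div (Real.rpow_pos_of_pos ht δ)]
    exact rpow_le_one_add hδ.le hδ' ht.le
  have hw1 : ∀ t : ℝ, 0 < t → 1 + t ≤ w t := fun t ht => by
    have := le_mul_of_one_le_right (by linarith : 0 ≤ 1 + t) (hv t ht)
    simp only [hw]
    linarith
  have hw2 : ∀ t : ℝ, 0 < t → (1 + t) * t ^ (-δ) ≤ w t := fun t ht => by
    have := le_mul_of_one_le_left (zero_le_one.trans (hv t ht)) (by linarith : 1 ≤ 1 + t)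
    simp only [hw]
    linarith
  have hB : CoeffBound w besselPoly 1 := by
    refine coeffBound_linear (c₀ := 1) (c₁ := c) (fun t ht => ?_) fun t ht => ?_
    · rw [one_mul]
      refine (abs_besselI0_le ht.le).trans (le_mul_of_one_le_left (Real.exp_pos t).le ?_)
      linarith [hw1 t ht]
    · rw [abs_of_nonneg (besselK0_nonneg t), ← mul_assoc]
      refine (hK t ht).trans ?_
      gcongr
      exact hw2 t ht
  have hT : CoeffBound w thetaPoly 1 := by
    refine coeffBound_linear (c₀ := 1) (c₁ := 1 + c) (fun t ht => ?_) fun t ht => ?_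
    · rw [one_mul]
      refine (abs_thetaI0_le ht.le).trans ?_
      gcongr
      linarith [hw1 t ht]
    · have h1 := (Real.exp_pos (-t)).le.trans (exp_neg_le_neg_thetaK0 ht)
      rw [abs_of_nonpos (by linarith), ← mul_assoc]
      refine (neg_thetaK0_le ht).trans ?_
      have h2 := mul_le_mul_of_nonneg_left (hK t ht) ht.le
      have h3 : t * ((1 + t) * t ^ (-δ)) ≤ w t := by
        have := zero_le_one.trans (hv t ht)
        simp only [hw]
        linarith
      have h4 : 1 ≤ w t := by linarith [hw1 t ht]
      calc Real.exp (-t) + t * besselK0 t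
          ≤ 1 * Real.exp (-t) + c * (t * ((1 + t) * t ^ (-δ))) * Real.exp (-t) := by linarith
        _ ≤ w t * Real.exp (-t) + c * w t * Real.exp (-t) := by gcongr
        _ = _ := by ring
  obtain ⟨c', h⟩ := (hB.pow (N - k)).mul (hT.pow k) b
  refine ⟨c', fun t ht => ?_⟩
  have h1 := mul_le_mul_of_nonneg_left (h t ht) ht.le
  have hd : (N - k) * 1 + k * 1 = N := by omega
  have hwN : t * w t ^ N = (1 + t) ^ (2 * N) := by
    simp only [hw]
    rw [mul_pow, ← pow_mul, ← Real.rpow_mul_natCast ht.le, neg_mul, hδdef,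
      inv_mul_cancel₀ hN'.ne', Real.rpow_neg_one]
    field_simp
  rw [hd] at h1
  rw [← hwN]
  refine h1.trans_eq ?_
  ring

/-- Since N < 2b the exponential rate is at most -1; half of it absorbs the polynomial factor
through one term of the series of exp((1+t)/2). -/
theorem exists_pow_mul_besselComponent_bound {N b k : ℕ} (hk : k ≤ N) (hb : N < 2 * b)
    (hN : 0 < N) (m : ℕ) :
    ∃ c : ℝ, ∀ t, 0 < t → |t ^ (m + 1) * besselComponent N b k t| ≤
      c * Real.exp (-(1 / 2) * t) := by
  obtain ⟨c, h⟩ := exists_besselComponent_bound hN (b := b) hk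
  have hc : 0 ≤ c := by
    have := (by positivity : (0 : ℝ) ≤ 1 * |besselComponent N b k 1|).trans (h 1 one_pos)
    exact nonneg_of_mul_nonneg_left this (by positivity)
  refine ⟨c * (2 ^ (2 * N + m) * ((2 * N + m).factorial * Real.exp (1 / 2))), fun t ht => ?_⟩
  have h1 := Real.pow_div_factorial_le_exp ((1 + t) / 2) (by positivity) (2 * N + m)
  rw [div_le_iff₀ (by positivity), div_pow, div_le_iff₀ (by positivity)] at h1
  have h2 : Real.exp (((N : ℝ) - 2 * b) * t) ≤ Real.exp (-t) := by
    apply Real.exp_le_exp.2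
    have : (N : ℝ) + 1 ≤ 2 * b := by exact_mod_cast hb
    nlinarith
  have h3 : Real.exp ((1 + t) / 2) * Real.exp (-t) =
      Real.exp (1 / 2) * Real.exp (-(1 / 2) * t) := by
    rw [← Real.exp_add, ← Real.exp_add]
    ring_nf
  calc |t ^ (m + 1) * besselComponent N b k t|
      = t ^ m * (t * |besselComponent N b k t|) := by
        rw [abs_mul, abs_of_pos (by positivity)]; ring
    _ ≤ t ^ m * (c * ((1 + t) ^ (2 * N) * Real.exp (((N : ℝ) - 2 * b) * t))) :=
        mul_le_mul_of_nonneg_left (h t ht) (by positivity)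
    _ ≤ (1 + t) ^ m * (c * ((1 + t) ^ (2 * N) * Real.exp (-t))) := by
        gcongr
        linarith
    _ = c * (1 + t) ^ (2 * N + m) * Real.exp (-t) := by ring
    _ ≤ c * (Real.exp ((1 + t) / 2) * (2 * N + m).factorial * 2 ^ (2 * N + m))
          * Real.exp (-t) := by gcongr
    _ = c * (2 ^ (2 * N + m) * ((2 * N + m).factorial
          * (Real.exp ((1 + t) / 2) * Real.exp (-t)))) := by ring
    _ = _ := by rw [h3]; ring

theorem integrableOn_pow_mul_besselComponent {N b k : ℕ} (hk : k ≤ N) (hb : N < 2 * b)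
    (hN : 0 < N) (m : ℕ) :
    IntegrableOn (fun t => t ^ (m + 1) * besselComponent N b k t) (Set.Ioi 0) := by
  obtain ⟨c, h⟩ := exists_pow_mul_besselComponent_bound hk hb hN m
  refine Integrable.mono' ((exp_neg_integrableOn_Ioi 0 one_half_pos).const_mul c) ?_ ?_
  · exact (((continuous_pow _).continuousOn).mul
      (continuousOn_besselComponent hk)).aestronglyMeasurable measurableSet_Ioi
  · filter_upwards [ae_restrict_mem measurableSet_Ioi] with t ht using h t ht

theorem tendsto_pow_mul_besselComponent_atTop {N b k : ℕ} (hk : k ≤ N) (hb : N < 2 * b)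
    (hN : 0 < N) (m : ℕ) :
    Tendsto (fun t => t ^ m * besselComponent N b k t) atTop (𝓝 0) := by
  obtain ⟨c, h⟩ := exists_pow_mul_besselComponent_bound hk hb hN m
  refine squeeze_zero_norm' (a := fun t => c * Real.exp (-(1 / 2) * t)) ?_ ?_
  · filter_upwards [eventually_ge_atTop 1] with t ht
    refine le_trans ?_ (h t (by linarith))
    rw [Real.norm_eq_abs, pow_succ, mul_right_comm, abs_mul _ t]
    exact le_mul_of_one_le_right (abs_nonneg _) (ht.trans (le_abs_self t))
  · have h1 : Tendsto (fun t : ℝ => -(1 / 2) * t) atTop atBot :=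
      tendsto_id.const_mul_atTop_of_neg (by norm_num)
    simpa using (Real.tendsto_exp_atBot.comp h1).const_mul c

theorem tendsto_pow_mul_besselComponent_zero {N b k : ℕ} (hk : k ≤ N) (hb : N < 2 * b)
    (hN : 0 < N) (m : ℕ) :
    Tendsto (fun t => t ^ (m + 2) * besselComponent N b k t) (𝓝[>] 0) (𝓝 0) := by
  obtain ⟨c, h⟩ := exists_pow_mul_besselComponent_bound hk hb hN m
  refine squeeze_zero_norm' (a := fun t => t * (c * Real.exp (-(1 / 2) * t))) ?_ ?_
  · filter_upwards [self_mem_nhdsWithin] with t ht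
    have ht : 0 < t := ht
    rw [Real.norm_eq_abs, pow_succ', mul_assoc, abs_mul, abs_of_pos ht]
    exact mul_le_mul_of_nonneg_left (h t ht) ht.le
  · have : Continuous fun t : ℝ => t * (c * Real.exp (-(1 / 2) * t)) := by fun_prop
    simpa using (this.tendsto 0).mono_left (nhdsWithin_le_nhds (s := Set.Ioi (0 : ℝ)))

/-! ### Moments of the components -/

/-- The moment `∫ t ^ (2 m + 1) F_k(t) dt` of a component, normalised so that it is a Bessel
moment for `k = 0`. -/
noncomputable def componentMoment (a b k m : ℕ) : ℝ :=
  ((a + b).choose b : ℝ)⁻¹ *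
    ∫ t in Set.Ioi (0 : ℝ), t ^ (2 * m + 1) * besselComponent (a + b) b k t

theorem choose_add_ne_zero (a b : ℕ) : ((a + b).choose b : ℝ) ≠ 0 :=
  Nat.cast_ne_zero.2 (Nat.choose_pos (Nat.le_add_left b a)).ne'

theorem besselMomentIntegrand_eq (a b m : ℕ) (t : ℝ) : besselMomentIntegrand a b m t =
    ((a + b).choose b : ℝ)⁻¹ * (t ^ m * besselComponent (a + b) b 0 t) := by
  have := choose_add_ne_zero a b
  rw [besselComponent_zero, besselMomentIntegrand]
  field_simp

theorem componentMoment_zero (a b m : ℕ) : componentMoment a b 0 m = IKM a b (2 * m + 1) := by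
  simp only [componentMoment, IKM, besselMomentIntegrand_eq, integral_const_mul]

theorem integrableOn_besselMomentIntegrand {a b : ℕ} (hab : a < b) (m : ℕ) :
    IntegrableOn (besselMomentIntegrand a b (m + 1)) (Set.Ioi 0) := by
  have h := (integrableOn_pow_mul_besselComponent (Nat.zero_le (a + b)) (b := b) (by omega)
    (by omega) m).const_mul ((a + b).choose b : ℝ)⁻¹
  exact h.congr (.of_forall fun t => (besselMomentIntegrand_eq a b (m + 1) t).symm)

theorem componentMoment_recurrence {a b : ℕ} (hab : a < b) {k : ℕ} (hk : k ≤ a + b) (m : ℕ) :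
    (2 * m + 2) * componentMoment a b k m
      + (((a + b : ℕ) : ℝ) - k) * componentMoment a b (k + 1) m
      + k * componentMoment a b (k - 1) (m + 1) = 0 := by
  have hb : a + b < 2 * b := by omega
  have hN : 0 < a + b := by omega
  have i0 := (integrableOn_pow_mul_besselComponent hk hb hN (2 * m)).const_mul (2 * m + 2 : ℝ)
  have i1 : IntegrableOn (fun t => (((a + b : ℕ) : ℝ) - k) *
      (t ^ (2 * m + 1) * besselComponent (a + b) b (k + 1) t)) (Set.Ioi 0) := by
    rcases hk.eq_or_lt with rfl | hk
    · simp
    · exact (integrableOn_pow_mul_besselComponent hk hb hN (2 * m)).const_mul _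
  have i2 := (integrableOn_pow_mul_besselComponent ((Nat.sub_le k 1).trans hk) hb hN
    (2 * (m + 1))).const_mul (k : ℝ)
  have h := integral_Ioi_eq_sub_of_hasDerivAt_of_tendsto (a := 0) (l₀ := 0) (l := 0)
    (f := fun t => t ^ (2 * m + 2) * besselComponent (a + b) b k t)
    (f' := fun t => (2 * m + 2) * (t ^ (2 * m + 1) * besselComponent (a + b) b k t)
      + (((a + b : ℕ) : ℝ) - k) * (t ^ (2 * m + 1) * besselComponent (a + b) b (k + 1) t)
      + k * (t ^ (2 * (m + 1) + 1) * besselComponent (a + b) b (k - 1) t))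
    (fun t ht => by
      have ht : 0 < t := ht
      refine ((hasDerivAt_pow (2 * m + 2) t).mul
        (hasDerivAt_besselComponent hk ht)).congr_deriv ?_
      rw [show 2 * m + 2 - 1 = 2 * m + 1 from rfl]
      push_cast
      field_simp
      ring)
    ((i0.add i1).add i2) (tendsto_pow_mul_besselComponent_zero hk hb hN (2 * m))
    (tendsto_pow_mul_besselComponent_atTop hk hb hN (2 * m + 2))
  have i01 : IntegrableOn (fun t => (2 * m + 2) * (t ^ (2 * m + 1) * besselComponent (a + b) b k t)
      + (((a + b : ℕ) : ℝ) - k) * (t ^ (2 * m + 1) * besselComponent (a + b) b (k + 1) t))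
      (Set.Ioi 0) := i0.add i1
  rw [integral_add i01 i2, integral_add i0 i1, integral_const_mul,
    integral_const_mul, integral_const_mul, sub_zero] at h
  simp only [componentMoment]
  linear_combination ((a + b).choose b : ℝ)⁻¹ * h

/-- This is the case k = N with no power of t in front, so the boundary value at 0 need not vanish.
The factor 0^a separates a = 0 from a ≥ 1. -/
theorem componentMoment_boundary {a b : ℕ} (hab : a < b) :
    ((a + b : ℕ) : ℝ) * componentMoment a b (a + b - 1) 0 = -(0 ^ a * (-1) ^ b) := by
  have hb : a + b < 2 * b := by omega
  have hN : 0 < a + b := by omega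
  have i := (integrableOn_pow_mul_besselComponent (Nat.sub_le (a + b) 1) hb hN
    (2 * 0)).const_mul ((a + b : ℕ) : ℝ)
  have h := integral_Ioi_eq_sub_of_hasDerivAt_of_tendsto (a := 0)
    (l₀ := (a + b).choose b * (0 ^ a * (-1) ^ b)) (l := 0)
    (f := besselComponent (a + b) b (a + b))
    (f' := fun t => ((a + b : ℕ) : ℝ) *
      (t ^ (2 * 0 + 1) * besselComponent (a + b) b (a + b - 1) t))
    (fun t ht => by
      refine (hasDerivAt_besselComponent le_rfl ht).congr_deriv ?_
      ring)
    i
    (by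
      have := ((tendsto_thetaI0_zero.pow a).mul (tendsto_thetaK0_zero.pow b)).const_mul
        ((a + b).choose b : ℝ)
      exact this.congr fun t => (besselComponent_self a b t).symm)
    (by simpa using tendsto_pow_mul_besselComponent_atTop le_rfl hb hN 0)
  rw [integral_const_mul] at h
  have hc := choose_add_ne_zero a b
  rw [componentMoment]
  linear_combination ((a + b).choose b : ℝ)⁻¹ * h
    - (0 ^ a * (-1) ^ b) * inv_mul_cancel₀ hc

/-! ### Solving the moment recurrence over ℚ -/

/-- The sign condition is what makes the induction work: the two contributions to each coefficient
have the same sign and cannot cancel. The falling factorial avoids division by N - k and allows k =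
N + 1, where it vanishes. -/
theorem exists_alternating_expansion (N : ℕ) (A : ℕ → ℕ → ℝ)
    (hA : ∀ k ≤ N, ∀ m : ℕ, (2 * m + 2) * A k m + ((N : ℝ) - k) * A (k + 1) m
      + k * A (k - 1) (m + 1) = 0) (k : ℕ) :
    k ≤ N + 1 → ∀ m : ℕ, ∃ c : ℕ → ℚ, (∀ j, 2 * j ≤ k → 0 < (-1) ^ j * c j) ∧
      (∀ j, k < 2 * j → c j = 0) ∧
      (-1) ^ k * (N.descFactorial k : ℝ) * A k m =
        ∑ j ∈ Finset.range (k + 1), (c j : ℝ) * A 0 (m + j) := by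
  have hdesc : ∀ k : ℕ, k ≤ N →
      (N.descFactorial (k + 1) : ℝ) = ((N : ℝ) - k) * N.descFactorial k := fun k hk => by
    rw [Nat.descFactorial_succ, Nat.cast_mul, Nat.cast_sub hk]
  induction k using Nat.strong_induction_on with
  | _ k ih =>
  intro hk m
  rcases k with _ | _ | k
  · refine ⟨fun j => if j = 0 then 1 else 0, fun j hj => ?_, fun j hj => ?_, by simp⟩
    · have : j = 0 := by omega
      simp [this]
    · have : j ≠ 0 := by omega
      simp [this]
  · refine ⟨fun j => if j = 0 then 2 * m + 2 else 0, fun j hj => ?_, fun j hj => ?_, ?_⟩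
    · have : j = 0 := by omega
      subst this
      simp only [pow_zero, one_mul, if_true]
      positivity
    · have : j ≠ 0 := by omega
      simp [this]
    · have h := hA 0 (Nat.zero_le N) m
      simp only [CharP.cast_eq_zero, sub_zero, zero_mul, add_zero, zero_add] at h
      simp [Finset.sum_range_succ]
      linarith
  · obtain ⟨c, hc, hc', hs⟩ := ih (k + 1) (by omega) (by omega) m
    obtain ⟨d, hd, hd', ht⟩ := ih k (by omega) (by omega) (m + 1)
    have hk' : k + 1 ≤ N := by omega
    have hkN : (0 : ℚ) < (k + 1) * ((N : ℚ) - k) := by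
      have : ((k + 1 : ℕ) : ℚ) ≤ N := by exact_mod_cast hk'
      push_cast at this
      have : 0 < (N : ℚ) - k := by linarith
      positivity
    -- The recurrence at k+1, multiplied by (-1)^(k+2) times the falling factorial of length k+1.
    -- The shift j - 1 comes from the moment index m + 1 in the expansion for k.
    refine ⟨fun j => (2 * m + 2) * c j
      - (k + 1) * ((N : ℚ) - k) * (if j = 0 then 0 else d (j - 1)), fun j hj => ?_,
      fun j hj => ?_, ?_⟩
    · rcases j with _ | j
      · have := hc 0 (by omega)
        simp only [pow_zero, one_mul] at this
        simp only [pow_zero, one_mul, if_true, mul_zero, sub_zero]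
        positivity
      · have h1 := hd j (by omega)
        have h2 : 0 ≤ (-1) ^ (j + 1) * c (j + 1) := by
          rcases le_or_gt (2 * (j + 1)) (k + 1) with h | h
          · exact (hc _ h).le
          · simp [hc' _ h]
        simp only [Nat.add_eq_zero_iff, one_ne_zero, and_false, if_false, Nat.add_sub_cancel]
        have h3 : (-1 : ℚ) ^ (j + 1) * ((2 * m + 2) * c (j + 1) - (k + 1) * ((N : ℚ) - k) * d j) =
            (2 * m + 2) * ((-1) ^ (j + 1) * c (j + 1))
              + (k + 1) * ((N : ℚ) - k) * ((-1) ^ j * d j) := by ring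
        rw [h3]
        positivity
    · have hj0 : j ≠ 0 := by omega
      simp [hj0, hc' j (by omega), hd' (j - 1) (by omega)]
    · have h := hA (k + 1) hk' m
      have e1 := hdesc (k + 1) hk'
      have e2 := hdesc k (by omega)
      have s1 : ∑ j ∈ Finset.range (k + 1 + 1 + 1), (c j : ℝ) * A 0 (m + j) =
          ∑ j ∈ Finset.range (k + 1 + 1), (c j : ℝ) * A 0 (m + j) := by
        rw [Finset.sum_range_succ _ (k + 1 + 1), hc' (k + 1 + 1) (by omega)]
        simp
      have s2 : ∑ j ∈ Finset.range (k + 1 + 1 + 1),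
          (((if j = 0 then 0 else d (j - 1) : ℚ)) : ℝ) * A 0 (m + j) =
          (∑ j ∈ Finset.range (k + 1), (d j : ℝ) * A 0 (m + 1 + j)) := by
        rw [Finset.sum_range_succ', Finset.sum_range_succ, hd']
        · simp [add_assoc, add_comm 1]
        · omega
      have s3 : ∑ j ∈ Finset.range (k + 1 + 1 + 1), (((2 * m + 2) * c j
          - (k + 1) * ((N : ℚ) - k) * (if j = 0 then 0 else d (j - 1)) : ℚ) : ℝ) * A 0 (m + j) =
          (2 * m + 2) * ∑ j ∈ Finset.range (k + 1 + 1 + 1), (c j : ℝ) * A 0 (m + j)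
          - (k + 1) * ((N : ℝ) - k) * ∑ j ∈ Finset.range (k + 1 + 1 + 1),
            (((if j = 0 then 0 else d (j - 1) : ℚ)) : ℝ) * A 0 (m + j) := by
        rw [Finset.mul_sum, Finset.mul_sum, ← Finset.sum_sub_distrib]
        refine Finset.sum_congr rfl fun j _ => ?_
        push_cast
        ring
      rw [s3, s1, s2, ← hs, ← ht, e1, e2]
      simp only [Nat.add_sub_cancel] at h
      push_cast at h ⊢
      linear_combination (-1) ^ (k + 1 + 1) * ((N : ℝ) - k) * (N.descFactorial k : ℝ) * h

/-! ### Relations among Bessel moments and rank bounds -/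

theorem mem_span_of_sum_eq {x : ℕ → ℝ} {V : Submodule ℚ ℝ} {c : ℕ → ℚ} {m d : ℕ}
    (hd : c d ≠ 0) (hx : ∀ j < d, x (m + j) ∈ V)
    (h : ∑ j ∈ Finset.range (d + 1), (c j : ℝ) * x (m + j) ∈ V) : x (m + d) ∈ V := by
  rw [Finset.sum_range_succ] at h
  have h1 : ∑ j ∈ Finset.range d, (c j : ℝ) * x (m + j) ∈ V :=
    V.sum_mem fun j hj => by
      simpa only [Rat.smul_def] using V.smul_mem (c j) (hx j (Finset.mem_range.1 hj))
  have h2 := V.smul_mem (c d)⁻¹ ((V.add_mem_iff_right h1).1 h)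
  have h3 : (c d : ℝ) ≠ 0 := by exact_mod_cast hd
  rwa [Rat.smul_def, Rat.cast_inv, inv_mul_cancel_left₀ h3] at h2

/-- Strong induction with V the span of the first d terms. Allowing arbitrary V lets a relation be
used simply by solving for its top term. -/
theorem rank_span_range_le_of_recurrence {x : ℕ → ℝ} {d : ℕ}
    (h : ∀ k, d ≤ k → ∀ V : Submodule ℚ ℝ, (∀ j < k, x j ∈ V) → x k ∈ V) :
    Module.rank ℚ (Submodule.span ℚ (Set.range x)) ≤ (d : Cardinal) := by
  classical
  set s : Finset ℝ := (Finset.range d).image x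
  have hs : Set.range x ⊆ Submodule.span ℚ (s : Set ℝ) := by
    rintro _ ⟨k, rfl⟩
    induction k using Nat.strong_induction_on with
    | _ k ih =>
    rcases lt_or_ge k d with hk | hk
    · exact Submodule.subset_span (Finset.mem_coe.2
        (Finset.mem_image_of_mem x (Finset.mem_range.2 hk)))
    · exact h k hk _ ih
  refine (Submodule.rank_mono (Submodule.span_le.2 hs)).trans ((rank_span_finset_le s).trans ?_)
  exact_mod_cast Finset.card_image_le.trans_eq (Finset.card_range d)

theorem exists_IKM_expansion {a b : ℕ} (hab : a < b) {k : ℕ} (hk : k ≤ a + b + 1) (m : ℕ) :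
    ∃ c : ℕ → ℚ, (∀ j ≤ k / 2, c j ≠ 0) ∧
      (-1) ^ k * ((a + b).descFactorial k : ℝ) * componentMoment a b k m =
        ∑ j ∈ Finset.range (k / 2 + 1), (c j : ℝ) * IKM a b (2 * (m + j) + 1) := by
  obtain ⟨c, hc, hc', h⟩ := exists_alternating_expansion (a + b) (componentMoment a b)
    (fun k hk m => componentMoment_recurrence hab hk m) k hk m
  refine ⟨c, fun j hj h0 => ?_, ?_⟩
  · have := hc j (by omega)
    simp [h0] at this
  · rw [h]
    simp only [componentMoment_zero]
    refine (Finset.sum_subset (Finset.range_subset_range.2 (by omega)) fun j _ hj => ?_).symm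
    rw [hc' j (by rw [Finset.mem_range] at hj; omega)]
    simp

/-- The recurrence of the moments; all of its coefficients are nonzero. -/
theorem exists_IKM_linear_relation {a b : ℕ} (hab : a < b) (m : ℕ) :
    ∃ c : ℕ → ℚ, (∀ j ≤ (a + b + 1) / 2, c j ≠ 0) ∧
      ∑ j ∈ Finset.range ((a + b + 1) / 2 + 1), (c j : ℝ) * IKM a b (2 * (m + j) + 1) = 0 := by
  obtain ⟨c, hc, h⟩ := exists_IKM_expansion hab le_rfl m
  refine ⟨c, hc, ?_⟩
  rw [← h, Nat.descFactorial_of_lt (Nat.lt_succ_self _)]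
  simp

theorem exists_IKM_initial_relation {a b : ℕ} (hab : a < b) :
    ∃ (c : ℕ → ℚ) (r : ℚ), (∀ j ≤ (a + b - 1) / 2, c j ≠ 0) ∧ (1 ≤ a → r = 0) ∧
      ∑ j ∈ Finset.range ((a + b - 1) / 2 + 1), (c j : ℝ) * IKM a b (2 * j + 1) = r := by
  obtain ⟨c, hc, h⟩ := exists_IKM_expansion hab (k := a + b - 1) (by omega) 0
  have hN : ((a + b : ℕ) : ℝ) ≠ 0 := Nat.cast_ne_zero.2 (by omega)
  have hA := componentMoment_boundary hab
  -- The rational r is the left side of the expansion at k = N - 1, with A(N-1,0) evaluated by the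
  -- boundary identity.
  refine ⟨c, (-1) ^ (a + b - 1) * ((a + b).descFactorial (a + b - 1) : ℚ)
    * (((a + b : ℕ) : ℚ)⁻¹ * -(0 ^ a * (-1) ^ b)), hc, fun ha => ?_, ?_⟩
  · simp [zero_pow (by omega : a ≠ 0)]
  · simp only [zero_add] at h
    rw [← h, (eq_inv_mul_iff_mul_eq₀ hN).2 hA]
    push_cast
    ring

theorem rank_span_IKM_le {a b : ℕ} (hab : a < b) :
    Module.rank ℚ (Submodule.span ℚ (Set.range fun k : ℕ => IKM a b (2 * k + 1)))
      ≤ (((a + b + 1) / 2 : ℕ) : Cardinal) := by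
  refine rank_span_range_le_of_recurrence fun k hk V hV => ?_
  obtain ⟨m, rfl⟩ := Nat.exists_eq_add_of_le' hk
  obtain ⟨c, hc, h⟩ := exists_IKM_linear_relation hab m
  exact mem_span_of_sum_eq (x := fun k => IKM a b (2 * k + 1)) (hc _ le_rfl)
    (fun j hj => hV _ (by omega)) (h ▸ V.zero_mem)

theorem rank_span_IKM_le_of_pos {a b : ℕ} (ha : 1 ≤ a) (hab : a < b) :
    Module.rank ℚ (Submodule.span ℚ (Set.range fun k : ℕ => IKM a b (2 * k + 1)))
      ≤ (((a + b - 1) / 2 : ℕ) : Cardinal) := by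
  refine rank_span_range_le_of_recurrence fun k hk V hV => ?_
  -- Only the index (a+b-1)/2 needs the initial relation; the next one is (a+b+1)/2, the order of
  -- the general recurrence.
  rcases hk.eq_or_lt with rfl | hk
  · obtain ⟨c, r, hc, hr, h⟩ := exists_IKM_initial_relation hab
    rw [hr ha, Rat.cast_zero] at h
    have := mem_span_of_sum_eq (x := fun k => IKM a b (2 * k + 1)) (m := 0) (V := V)
      (hc _ le_rfl) (fun j hj => hV _ (by omega)) (by simpa only [zero_add, h] using V.zero_mem)
    simpa only [zero_add] using this
  · obtain ⟨m, rfl⟩ := Nat.exists_eq_add_of_le' (by omega : (a + b + 1) / 2 ≤ k)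
    obtain ⟨c, hc, h⟩ := exists_IKM_linear_relation hab m
    exact mem_span_of_sum_eq (x := fun k => IKM a b (2 * k + 1)) (hc _ le_rfl)
      (fun j hj => hV _ (by omega)) (h ▸ V.zero_mem)

theorem theorem1p2 :
    (∀ a b : ℕ, 1 ≤ a → a < b →
      (∀ k : ℕ, IntegrableOn (besselMomentIntegrand a b (2 * k + 1)) (Set.Ioi 0)) ∧
      ¬ LinearIndependent ℚ
          (fun k : Fin ((a + b - 1) / 2 + 1) => IKM a b (2 * (k : ℕ) + 1)) ∧
      Module.rank ℚ (Submodule.span ℚ (Set.range fun k : ℕ => IKM a b (2 * k + 1)))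
        ≤ (((a + b - 1) / 2 : ℕ) : Cardinal)) ∧
    (∀ n : ℕ, 2 ≤ n →
      (∀ k : ℕ, IntegrableOn (besselMomentIntegrand 0 n (2 * k + 1)) (Set.Ioi 0)) ∧
      ¬ LinearIndependent ℚ
          (fun i : Option (Fin ((n - 1) / 2 + 1)) =>
            i.elim (1 : ℝ) (fun k => IKM 0 n (2 * (k : ℕ) + 1))) ∧
      Module.rank ℚ (Submodule.span ℚ (Set.range fun k : ℕ => IKM 0 n (2 * k + 1)))
        ≤ (((n + 1) / 2 : ℕ) : Cardinal)) := by
  refine ⟨fun a b ha hab => ⟨fun k => integrableOn_besselMomentIntegrand hab _, ?_,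
    rank_span_IKM_le_of_pos ha hab⟩, fun n hn => ?_⟩
  · obtain ⟨c, r, hc, hr, h⟩ := exists_IKM_initial_relation hab
    rw [Fintype.not_linearIndependent_iff]
    refine ⟨fun k => c k, ?_, 0, hc _ (Nat.zero_le _)⟩
    rw [Finset.sum_range, hr ha, Rat.cast_zero] at h
    simpa only [Rat.smul_def] using h
  · have hab : 0 < n := by omega
    refine ⟨fun k => integrableOn_besselMomentIntegrand hab _, ?_,
      by simpa only [zero_add] using rank_span_IKM_le hab⟩
    obtain ⟨c, r, hc, -, h⟩ := exists_IKM_initial_relation hab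
    simp only [zero_add] at hc h
    rw [Fintype.not_linearIndependent_iff]
    -- The boundary constant r moves to the entry 1; nontriviality is witnessed by c 0, so r may
    -- take any value.
    refine ⟨fun i => i.elim (-r) fun k => c k, ?_, some 0, hc _ (Nat.zero_le _)⟩
    rw [Finset.sum_range] at h
    rw [Fintype.sum_option]
    simp only [Option.elim_none, Option.elim_some, Rat.smul_def, h]
    push_cast
    ring
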